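/- Let $k\ge 1$ and $n\ge 0$ be integers, fix a norm $\|\cdot\|$ on $\mathbb R^n$ (and use the corresponding operator norms for matrices and for row vectors), and let $D=\{(x,y)\in\mathbb R^n\times\mathbb R:\|x\|\le 1,\ |y|\le 1\}$, $D_+=\{(x,y)\in D: y>0\}$, $D_-=\{(x,y)\in D: y<0\}$, $D_0=\{(x,y)\in D: y=0\}$, $D^*=D_+\cup D_-$. For a function $f$ on $D^*$ put $\|f\|_D=\sup_{D^*}\|f\|$. Let $T=(F,G):D^*\to D$ be of class $C^{k+1}$ with $\partial_yG\neq 0$ on $D^*$, and put $A=\partial_xF\,(\partial_yG)^{-1}$, $B=\partial_yF\,(\partial_yG)^{-1}$, $C=\partial_xG\,(\partial_yG)^{-1}$ (an $n\times n$ matrix, a column vector and a row vector). Assume: $(L_1)$ There are a neighbourhood $U$ of $D_0$ and constants $\alpha>0$, $\gamma>k-1$, $K>0$, $x^*_\pm,B^*_\pm\in\mathbb R^n$, $y^*_\pm\in\mathbb R$, $A^*_\pm\in\mathbb R\setminus\{0\}$ such that on $U\cap D_\pm$ $$F(x,y)=x^*_\pm+|y|^\alpha[B^*_\pm+\varphi_\pm(x,y)],\qquad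 G(x,y)=y^*_\pm+|y|^\alpha[A^*_\pm+\psi_\pm(x,y)],$$ where $\varphi_\pm,\psi_\pm$ are $C^{k+1}$ and, for all $l,m\ge 0$ with $l+m\le k+1$, $$\left\|\frac{\partial^{l+m}\varphi_\pm}{\partial x^l\partial y^m}(x,y)\right\|\le K|y|^{\gamma-m},\qquad \left\|\frac{\partial^{l+m}\psi_\pm}{\partial x^l\partial y^m}(x,y)\right\|\le K|y|^{\gamma-m}.$$ $(L_2)$ $1-\|A\|_D>2\sqrt{\|B\|_D\|C\|_D}$. Put $\Delta=(1-\|A\|_D)^2-4\|B\|_D\|C\|_D$ and let $L$ be any constant with $$\frac{2\|C\|_D}{1-\|A\|_D+\sqrt\Delta}\le L\quad\text{and}\quad 2\|B\|_D\,L<1-\|A\|_D+\sqrt\Delta .$$ (If $\|B\|_D\ne 0$, this says that $L$ is at least the smaller root and less than the larger root of $\|B\|_Ds^2-(1-\|A\|_D)s+\|C\|_D=0$; the smaller root $L=\frac{1-\|A\|_D-\sqrt\Delta}{2\|B\|_D}$ itself is allowed.) Let $\mathcal A_L$ be the set of continuous functions $\nu$ from $D$ to the row vectors of length $n$ with $\|\nu\|\le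 L$ on $D$ and $\nu=0$ on $D_0$. For $\nu\in\mathcal A_L$ define $\Gamma(\nu)$ on $D$ by $$\Gamma(\nu)(x,y)=\frac{\nu(T(x,y))\,A(x,y)-C(x,y)}{1-\nu(T(x,y))\,B(x,y)}\ \text{ if } y\ne 0,\qquad \Gamma(\nu)(x,0)=0 .$$ If $\mu\in\mathcal A_L$ is of class $C^k$ on $D$, then (a) $\lim_{(a,b)\to(x,0)}D^i(\Gamma(\mu))(a,b)=0$ for all $1\le i\le k$ and all $(x,0)\in D_0$; (b) $\Gamma(\mu)$ belongs to $\mathcal A_L$, is of class $C^k$ on $D$, and $D^i\Gamma(\mu)(x,0)=0$ for all $1\le i\le k$ and all $(x,0)\in D_0$. -/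

import Mathlib

open Set Filter Topology

noncomputable section

namespace LorenzFoliation

/- `E` is the space `ℝⁿ` of the variable `x`, with an arbitrary norm; row vectors of length `n` are
elements of the dual `E →L[ℝ] ℝ`, and matrices are continuous linear maps with the operator norm. -/
variable {E : Type*} [NormedAddCommGroup E] [NormedSpace ℝ E]

/-- `D = {(x, y) : ‖x‖ ≤ 1, |y| ≤ 1}`. -/
def dom (E : Type*) [NormedAddCommGroup E] : Set (E × ℝ) := {p | ‖p.1‖ ≤ 1 ∧ |p.2| ≤ 1}

/-- `D₊`. -/
def domPos (E : Type*) [NormedAddCommGroup E] : Set (E × ℝ) := {p | p ∈ dom E ∧ 0 < p.2}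

/-- `D₋`. -/
def domNeg (E : Type*) [NormedAddCommGroup E] : Set (E × ℝ) := {p | p ∈ dom E ∧ p.2 < 0}

/-- `D₀`. -/
def domZero (E : Type*) [NormedAddCommGroup E] : Set (E × ℝ) := {p | p ∈ dom E ∧ p.2 = 0}

/-- `D* = D₋ ∪ D₊`. -/
def domStar (E : Type*) [NormedAddCommGroup E] : Set (E × ℝ) := domNeg E ∪ domPos E

/-- `∂ₓF` for `T = (F, G)`, at points of `D*` (one-sided at boundary points of `D`). -/
def dxF (T : E × ℝ → E × ℝ) (p : E × ℝ) : E →L[ℝ] E :=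
  (fderivWithin ℝ (fun q => (T q).1) (domStar E) p).comp (ContinuousLinearMap.inl ℝ E ℝ)

/-- `∂_yF`. -/
def dyF (T : E × ℝ → E × ℝ) (p : E × ℝ) : E :=
  fderivWithin ℝ (fun q => (T q).1) (domStar E) p (0, 1)

/-- `∂ₓG`. -/
def dxG (T : E × ℝ → E × ℝ) (p : E × ℝ) : E →L[ℝ] ℝ :=
  (fderivWithin ℝ (fun q => (T q).2) (domStar E) p).comp (ContinuousLinearMap.inl ℝ E ℝ)

/-- `∂_yG`. -/
def dyG (T : E × ℝ → E × ℝ) (p : E × ℝ) : ℝ :=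
  fderivWithin ℝ (fun q => (T q).2) (domStar E) p (0, 1)

/-- `A = ∂ₓF (∂_yG)⁻¹`. -/
def matA (T : E × ℝ → E × ℝ) (p : E × ℝ) : E →L[ℝ] E := (dyG T p)⁻¹ • dxF T p

/-- `B = ∂_yF (∂_yG)⁻¹`. -/
def colB (T : E × ℝ → E × ℝ) (p : E × ℝ) : E := (dyG T p)⁻¹ • dyF T p

/-- `C = ∂ₓG (∂_yG)⁻¹`. -/
def rowC (T : E × ℝ → E × ℝ) (p : E × ℝ) : E →L[ℝ] ℝ := (dyG T p)⁻¹ • dxG T p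

/-- `‖f‖_D`, the supremum of `‖f‖` over `D*`. It is only applied to `A`, `B`, `C` of Lorenz-type maps;
these are bounded on `D*`: near `D₀` by the normal form below, and elsewhere by compactness. -/
def supNorm {H : Type*} [NormedAddCommGroup H] (f : E × ℝ → H) : ℝ :=
  sSup ((fun p => ‖f p‖) '' domStar E)

/-- The mixed partial derivative `∂^{l+m} f / ∂x^l ∂y^m` at `p`, computed within `S`, as a function of
the `l` directions `v` in the `x`-space. -/
def mixedPartial {H : Type*} [NormedAddCommGroup H] [NormedSpace ℝ H] (l m : ℕ) (f : E × ℝ → H)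
    (S : Set (E × ℝ)) (p : E × ℝ) (v : Fin l → E) : H :=
  iteratedFDerivWithin ℝ (l + m) f S p
    (Fin.append (fun i : Fin l => ((v i, 0) : E × ℝ)) (fun _ : Fin m => ((0, 1) : E × ℝ)))

/-- `f` is of class `C^{k+1}` on `S` and, in the operator norm of `l`-linear maps,
`‖∂^{l+m} f / ∂x^l ∂y^m‖ ≤ K |y|^{γ-m}` on `S` whenever `l + m ≤ k + 1`. -/
def PartialsBounded {H : Type*} [NormedAddCommGroup H] [NormedSpace ℝ H] (k : ℕ) (γ K : ℝ)
    (S : Set (E × ℝ)) (f : E × ℝ → H) : Prop :=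
  ContDiffOn ℝ ((k + 1 : ℕ) : WithTop ℕ∞) f S ∧
    ∀ l m : ℕ, l + m ≤ k + 1 → ∀ p ∈ S, ∀ v : Fin l → E,
      ‖mixedPartial l m f S p v‖ ≤ K * |p.2| ^ (γ - m) * ∏ i, ‖v i‖

/-- The normal form of `T = (F, G)` on a one-sided neighbourhood `S` of `D₀`:
`F = x* + |y|^α (B* + φ)` and `G = y* + |y|^α (A* + ψ)` with `A* ≠ 0`. -/
def NormalFormOn (k : ℕ) (α γ K : ℝ) (T : E × ℝ → E × ℝ) (S : Set (E × ℝ)) : Prop :=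
  ∃ (xs Bs : E) (ys As : ℝ) (φ : E × ℝ → E) (ψ : E × ℝ → ℝ),
    As ≠ 0 ∧ PartialsBounded k γ K S φ ∧ PartialsBounded k γ K S ψ ∧
    ∀ p ∈ S, (T p).1 = xs + |p.2| ^ α • (Bs + φ p) ∧ (T p).2 = ys + |p.2| ^ α * (As + ψ p)

/-- Condition `(L₁)`. -/
def ConditionL1 (k : ℕ) (T : E × ℝ → E × ℝ) : Prop :=
  ∃ (U : Set (E × ℝ)) (α γ K : ℝ), IsOpen U ∧ domZero E ⊆ U ∧ 0 < α ∧ (k : ℝ) - 1 < γ ∧ 0 < K ∧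
    NormalFormOn k α γ K T (U ∩ domPos E) ∧ NormalFormOn k α γ K T (U ∩ domNeg E)

/-- Condition `(L₂)`. -/
def ConditionL2 (T : E × ℝ → E × ℝ) : Prop :=
  2 * √(supNorm (colB T) * supNorm (rowC T)) < 1 - supNorm (matA T)

/-- A `C^{k+1}` map `T = (F, G) : D* → D` with `∂_yG` non-vanishing on `D*`, satisfying `(L₁)` and
`(L₂)`. (Only the values of `T` on `D*` matter.) -/
structure IsLorenzTypeMap (k : ℕ) (T : E × ℝ → E × ℝ) : Prop where
  mapsTo : MapsTo T (domStar E) (dom E)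
  contDiffOn : ContDiffOn ℝ ((k + 1 : ℕ) : WithTop ℕ∞) T (domStar E)
  dyG_ne_zero : ∀ p ∈ domStar E, dyG T p ≠ 0
  l1 : ConditionL1 k T
  l2 : ConditionL2 T

/-- The discriminant `(1 - ‖A‖_D)² - 4 ‖B‖_D ‖C‖_D`. -/
def discr (T : E × ℝ → E × ℝ) : ℝ :=
  (1 - supNorm (matA T)) ^ 2 - 4 * supNorm (colB T) * supNorm (rowC T)

/-- The smaller root of `‖B‖_D s² - (1 - ‖A‖_D) s + ‖C‖_D = 0`. For `‖B‖_D ≠ 0` it equals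
`(1 - ‖A‖_D - √discr) / (2 ‖B‖_D)`; the form used here is also right for `‖B‖_D = 0`. -/
def smallRoot (T : E × ℝ → E × ℝ) : ℝ :=
  2 * supNorm (rowC T) / (1 - supNorm (matA T) + √(discr T))

/-- The set `𝒜_L` of functions on `D` that are continuous, bounded by `L`, and zero on `D₀`. -/
def spaceA (E : Type*) [NormedAddCommGroup E] [NormedSpace ℝ E] (L : ℝ) :
    Set (E × ℝ → (E →L[ℝ] ℝ)) :=
  {ν | ContinuousOn ν (dom E) ∧ (∀ p ∈ dom E, ‖ν p‖ ≤ L) ∧ ∀ x : E, ‖x‖ ≤ 1 → ν (x, 0) = 0}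

open Classical in
/-- The graph transform `Γ(ν) = (ν∘T A - C) / (1 - ν∘T B)` for `y ≠ 0`, and `0` for `y = 0`. -/
def graphTransform (T : E × ℝ → E × ℝ) (ν : E × ℝ → (E →L[ℝ] ℝ)) (p : E × ℝ) : E →L[ℝ] ℝ :=
  if p.2 = 0 then 0
  else (1 - ν (T p) (colB T p))⁻¹ • ((ν (T p)).comp (matA T p) - rowC T p)

end LorenzFoliation

end

/-!
The functions `A`, `B`, `C` and `T` are studied near `D₀` through weights: on a one-sided strip
`0 < ± y < δ`, a function `f` has weight `r` (`HasWeight r k`) if `‖D^i f‖ = O(|y|^{r-i})` for all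
`i ≤ k`. Weights add up under products, weight `0` is preserved by inversion away from `0` and by
composition with `C^k` functions that have bounded derivatives, and `|y|^r` has weight `r`.

In the normal form of `T`, the bounds on mixed partial derivatives say that `φ` and `ψ` have weight
`γ`, and that `∂ₓφ` and `∂ₓψ` still have weight `γ` (whereas `∂_y` lowers it by one); to pass from
mixed partials to full derivatives, the symmetry of iterated derivatives within a set is proved
first (`iteratedFDerivWithin_comp_perm`). One has `∂_yG = |y|^{α-1} g` with `g` of weight `0` and
bounded away from zero close to `D₀`, and the powers `|y|^{α-1}` cancel in `A`, `B`, `C`: thus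
`A = |y| ∂ₓφ / g` and `C = |y| ∂ₓψ / g` have weight `γ + 1 > k`, while `B` and `T` have weight `0`
(`NormalFormOn.exists_hasWeight`).

Consequently `Γ(μ) = (1 - μ∘T B)⁻¹ (μ∘T A - C)` has weight `γ + 1 > k`
(`hasWeight_graphTransform`): its derivatives of order `i ≤ k` are `O(|y|^{γ+1-i})` and tend to
zero at `D₀`, and those of order `i < k` are even `o(|y|)`. So the derivatives of `Γ(μ)` on `D*`,
extended by zero, form a Taylor series on `D` (`contDiffOn_dom_of_hasWeight`), which gives
smoothness and flatness on `D₀`. The bound `‖Γ(μ)‖ ≤ L` holds because `L` lies between the roots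
of `‖B‖_D s² - (1 - ‖A‖_D) s + ‖C‖_D` (`quadratic_nonpos`); the suprema are finite by the weight
estimates near `D₀` and by compactness elsewhere.
-/

namespace LorenzFoliation

/-! ### Symmetry of iterated derivatives -/

section Symmetry

variable {V W : Type*} [NormedAddCommGroup V] [NormedSpace ℝ V] [NormedAddCommGroup W]
  [NormedSpace ℝ W]

theorem iteratedFDerivWithin_comp_swap {n : ℕ} {f : V → W} {S : Set V}
    (hf : ContDiffOn ℝ ((n + 1 : ℕ) : WithTop ℕ∞) f S) (hS : UniqueDiffOn ℝ S)
    (hS' : S ⊆ closure (interior S)) (i : Fin n) {x : V} (hx : x ∈ S) (v : Fin (n + 1) → V) :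
    iteratedFDerivWithin ℝ (n + 1) f S x (v ∘ Equiv.swap i.castSucc i.succ) =
      iteratedFDerivWithin ℝ (n + 1) f S x v := by
  induction n generalizing x with
  | zero => exact i.elim0
  | succ n ih =>
    have hdiff : DifferentiableOn ℝ (iteratedFDerivWithin ℝ (n + 1) f S) S :=
      hf.differentiableOn_iteratedFDerivWithin (by exact_mod_cast Nat.lt_succ_self (n + 1)) hS
    rw [iteratedFDerivWithin_succ_apply_left, iteratedFDerivWithin_succ_apply_left]
    induction i using Fin.cases with
    | zero =>
      -- The two outermost directions: symmetry of the second derivative of `D^n f`.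
      have hC2 : ContDiffWithinAt ℝ 2 (iteratedFDerivWithin ℝ n f S) S x :=
        (hf x hx).iteratedFDerivWithin_right hS (by norm_cast; omega) hx
      have hsymm : IsSymmSndFDerivWithinAt ℝ (iteratedFDerivWithin ℝ n f S) S x :=
        hC2.isSymmSndFDerivWithinAt (by simp) hS (hS' hx) hx
      have hdiff' : DifferentiableWithinAt ℝ
          (fderivWithin ℝ (iteratedFDerivWithin ℝ n f S) S) S x :=
        (hC2.fderivWithin_right (m := 1) hS (by norm_num) hx).differentiableWithinAt one_ne_zero
      have key : ∀ w : Fin (n + 2) → V,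
          (fderivWithin ℝ (iteratedFDerivWithin ℝ (n + 1) f S) S x (w 0)) (Fin.tail w) =
          fderivWithin ℝ (fderivWithin ℝ (iteratedFDerivWithin ℝ n f S) S) S x (w 0) (w 1)
            (Fin.tail (Fin.tail w)) := by
        intro w
        have h1 := (hdiff x hx).hasFDerivWithinAt.continuousMultilinear_apply_const (Fin.tail w)
        have h3 := ((hdiff'.hasFDerivWithinAt.clm_apply
          (hasFDerivWithinAt_const (Fin.tail w 0) x S))).continuousMultilinear_apply_const
            (Fin.tail (Fin.tail w))
        simpa using! DFunLike.congr_fun ((hS x hx).eq h1 h3) (w 0)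
      rw [key, key, hsymm.eq]
      have e0 : (v ∘ Equiv.swap (0 : Fin (n + 1)).castSucc (0 : Fin (n + 1)).succ) 0 = v 1 := by
        simp
      have e1 : (v ∘ Equiv.swap (0 : Fin (n + 1)).castSucc (0 : Fin (n + 1)).succ) 1 = v 0 := by
        simp
      have e2 : Fin.tail (Fin.tail
          (v ∘ Equiv.swap (0 : Fin (n + 1)).castSucc (0 : Fin (n + 1)).succ)) =
          Fin.tail (Fin.tail v) := by
        funext j
        simp only [Fin.tail, Function.comp_apply]
        rw [Equiv.swap_apply_of_ne_of_ne]
        · simp [Fin.ext_iff]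
        · simp [Fin.ext_iff]
      rw [e0, e1, e2]
    | succ j =>
      -- The outermost direction is fixed, so the identity is the derivative of the one for `D^n f`.
      have e0 : (v ∘ Equiv.swap j.succ.castSucc j.succ.succ) 0 = v 0 := by
        simp only [Function.comp_apply]
        rw [Equiv.swap_apply_of_ne_of_ne]
        · simp [Fin.ext_iff]
        · simp [Fin.ext_iff]
      have e1 : Fin.tail (v ∘ Equiv.swap j.succ.castSucc j.succ.succ) =
          Fin.tail v ∘ Equiv.swap j.castSucc j.succ := by
        funext l
        simp only [Fin.tail, Function.comp_apply, Fin.castSucc_succ]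
        rw [← (Fin.succ_injective _).map_swap]
      have h := (hdiff x hx).hasFDerivWithinAt
      rw [e0, e1]
      have h1 := h.continuousMultilinear_apply_const (Fin.tail v ∘ Equiv.swap j.castSucc j.succ)
      have h2 := h.continuousMultilinear_apply_const (Fin.tail v)
      have h3 := h2.congr (f₁ := fun y => iteratedFDerivWithin ℝ (n + 1) f S y
        (Fin.tail v ∘ Equiv.swap j.castSucc j.succ))
        (fun y hy => ih (hf.of_le (by norm_cast; omega)) j hy _)
        (ih (hf.of_le (by norm_cast; omega)) j hx _)
      have h4 := (hS x hx).eq h1 h3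
      exact DFunLike.congr_fun h4 (v 0)

/-- The `n`-th derivative of a `C^n` function is symmetric: adjacent transpositions generate the
symmetric group. -/
theorem iteratedFDerivWithin_comp_perm {n : ℕ} {f : V → W} {S : Set V}
    (hf : ContDiffOn ℝ (n : WithTop ℕ∞) f S) (hS : UniqueDiffOn ℝ S)
    (hS' : S ⊆ closure (interior S)) {x : V} (hx : x ∈ S) (σ : Equiv.Perm (Fin n))
    (v : Fin n → V) :
    iteratedFDerivWithin ℝ n f S x (v ∘ σ) = iteratedFDerivWithin ℝ n f S x v := by
  cases n with
  | zero => exact congrArg _ (Subsingleton.elim _ _)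
  | succ n =>
    have hσ : σ ∈ Submonoid.closure
        (Set.range fun i : Fin n => Equiv.swap i.castSucc i.succ) := by
      rw [Equiv.Perm.mclosure_swap_castSucc_succ]; trivial
    induction hσ using Submonoid.closure_induction generalizing v with
    | mem τ hτ =>
      obtain ⟨i, rfl⟩ := hτ
      exact iteratedFDerivWithin_comp_swap hf hS hS' i hx v
    | one => rfl
    | mul τ ρ _ _ hτ hρ =>
      rw [Equiv.Perm.coe_mul, ← Function.comp_assoc, hρ, hτ]

end Symmetry

/-! ### From mixed partial derivatives to full derivatives -/

section MixedPartials

variable {E : Type*} [NormedAddCommGroup E] [NormedSpace ℝ E]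
  {H : Type*} [NormedAddCommGroup H] [NormedSpace ℝ H]

/-- Directions that are either horizontal or vertical may be reordered so that the horizontal ones
come first; the derivative along them is then a multiple of a mixed partial derivative. -/
theorem norm_iteratedFDerivWithin_piecewise_le {n : ℕ} {γ K : ℝ} {k : ℕ} {S : Set (E × ℝ)}
    {f : E × ℝ → H} (hf : PartialsBounded k γ K S f) (hS : UniqueDiffOn ℝ S)
    (hS' : S ⊆ closure (interior S)) (hn : n ≤ k + 1) {p : E × ℝ} (hp : p ∈ S)
    (s : Finset (Fin n)) (w : Fin n → E × ℝ) :
    ‖iteratedFDerivWithin ℝ n f S p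
        (s.piecewise (fun j => ((0 : E), (w j).2)) (fun j => ((w j).1, (0 : ℝ))))‖ ≤
      K * |p.2| ^ (γ - s.card) *
        ∏ j, ‖s.piecewise (fun j => ((0 : E), (w j).2)) (fun j => ((w j).1, (0 : ℝ))) j‖ := by
  obtain ⟨m, hm⟩ : ∃ m, s.card = m := ⟨_, rfl⟩
  obtain ⟨l, rfl⟩ : ∃ l, n = l + m :=
    ⟨n - m, by have := s.card_le_univ; simp at this; omega⟩
  have hc : sᶜ.card = l := by rw [Finset.card_compl, hm]; simp
  set u : Fin (l + m) → E × ℝ :=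
    s.piecewise (fun j => ((0 : E), (w j).2)) (fun j => ((w j).1, (0 : ℝ))) with hu
  let e₁ : Fin l ≃ {x // x ∈ sᶜ} := (sᶜ.equivFinOfCardEq hc).symm
  let e₂ : Fin m ≃ {x // x ∈ s} := (s.equivFinOfCardEq hm).symm
  let e₃ : Fin l ≃ {x // ¬ x ∈ s} := e₁.trans (Equiv.subtypeEquivRight (by simp))
  let σ : Equiv.Perm (Fin (l + m)) :=
    finSumFinEquiv.symm.trans (((Equiv.sumCongr e₃ e₂).trans (Equiv.sumComm _ _)).trans
      (Equiv.sumCompl (· ∈ s)))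
  have hσl : ∀ i : Fin l, u (σ (Fin.castAdd m i)) = ((w (e₃ i)).1, 0) := by
    intro i
    have : σ (Fin.castAdd m i) = (e₃ i : Fin (l + m)) := by simp [σ]
    rw [this, hu, Finset.piecewise_eq_of_notMem _ _ _ (e₃ i).2]
  have hσr : ∀ i : Fin m, u (σ (Fin.natAdd l i)) = (0, (w (e₂ i)).2) := by
    intro i
    have : σ (Fin.natAdd l i) = (e₂ i : Fin (l + m)) := by simp [σ]
    rw [this, hu, Finset.piecewise_eq_of_mem _ _ _ (e₂ i).2]
  have hcomp : u ∘ σ = fun i => (Fin.append (fun _ : Fin l => (1 : ℝ)) (fun j => (w (e₂ j)).2) i) •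
      (Fin.append (fun i : Fin l => (((w (e₃ i)).1, 0) : E × ℝ))
        (fun _ : Fin m => ((0, 1) : E × ℝ)) i) := by
    funext i
    refine Fin.addCases (fun i => ?_) (fun i => ?_) i
    · simp [hσl]
    · simp [hσr]
  have hprod : ∏ j, ‖u j‖ = (∏ i : Fin l, ‖(w (e₃ i)).1‖) * ∏ j : Fin m, |(w (e₂ j)).2| := by
    rw [← Equiv.prod_comp σ, Fin.prod_univ_add]
    simp [hσl, hσr, Prod.norm_def]
  rw [← iteratedFDerivWithin_comp_perm (hf.1.of_le (by exact_mod_cast hn)) hS hS' hp σ u, hcomp,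
    ContinuousMultilinearMap.map_smul_univ, norm_smul, hprod, Fin.prod_univ_add]
  have h := hf.2 l m hn p hp (fun i => (w (e₃ i)).1)
  rw [mixedPartial] at h
  simp only [Fin.append_left, Fin.append_right, Finset.prod_const_one, one_mul, norm_prod,
    Real.norm_eq_abs]
  rw [hm]
  calc _ ≤ (∏ j : Fin m, |(w (e₂ j)).2|) *
        (K * |p.2| ^ (γ - m) * ∏ i : Fin l, ‖(w (e₃ i)).1‖) := by gcongr
    _ = _ := by ring

theorem norm_multilinear_le_of_piecewise {n : ℕ} (q : (E × ℝ) [×n]→L[ℝ] H) {M : ℝ}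
    (w : Fin n → E × ℝ)
    (h : ∀ s : Finset (Fin n),
      ‖q (s.piecewise (fun j => ((0 : E), (w j).2)) (fun j => ((w j).1, (0 : ℝ))))‖ ≤
        M * ∏ j, ‖w j‖) :
    ‖q w‖ ≤ 2 ^ n * M * ∏ j, ‖w j‖ := by
  have hw : w = (fun j => ((0 : E), (w j).2)) + (fun j => ((w j).1, (0 : ℝ))) := by
    funext j; simp
  conv_lhs => rw [hw, ContinuousMultilinearMap.map_add_univ]
  refine (norm_sum_le _ _).trans ((Finset.sum_le_sum fun s _ => h s).trans ?_)
  simp [mul_assoc]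

omit [NormedSpace ℝ E] in
theorem prod_norm_piecewise_le {n : ℕ} (s : Finset (Fin n)) (w : Fin n → E × ℝ) :
    ∏ j, ‖s.piecewise (fun j => ((0 : E), (w j).2)) (fun j => ((w j).1, (0 : ℝ))) j‖ ≤
      ∏ j, ‖w j‖ := by
  refine Finset.prod_le_prod (fun _ _ => norm_nonneg _) fun j _ => ?_
  by_cases hj : j ∈ s
  · simp [hj, Prod.norm_def]
  · simp [hj, Prod.norm_def]

end MixedPartials

/-! ### Functions with weighted derivative bounds -/

section Weights

variable {E : Type*} [NormedAddCommGroup E] [NormedSpace ℝ E]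
  {H : Type*} [NormedAddCommGroup H] [NormedSpace ℝ H]
  {H' : Type*} [NormedAddCommGroup H'] [NormedSpace ℝ H']
  {H'' : Type*} [NormedAddCommGroup H''] [NormedSpace ℝ H'']

/-- `S` lies strictly on one side of `y = 0`, within `|y| ≤ 1`, and is thick enough for derivatives
within `S` to be unique and symmetric. The sign `σ = ±1` of `y` on `S` is recorded through the
identity `|y| = σ y`. -/
structure IsOneSided (σ : ℝ) (S : Set (E × ℝ)) : Prop where
  uniqueDiffOn : UniqueDiffOn ℝ S
  subset_closure_interior : S ⊆ closure (interior S)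
  ne_zero : ∀ p ∈ S, p.2 ≠ 0
  abs_le_one : ∀ p ∈ S, |p.2| ≤ 1
  abs_eq : ∀ p ∈ S, |p.2| = σ * p.2

/-- `f` is `C^n` on `S` and has weight `r` there: `‖D^i f‖ = O(|y|^{r-i})` for `i ≤ n`. -/
def HasWeight (r : ℝ) (n : ℕ) (S : Set (E × ℝ)) (f : E × ℝ → H) : Prop :=
  ContDiffOn ℝ (n : WithTop ℕ∞) f S ∧ ∃ C : ℝ, 0 ≤ C ∧ ∀ i ≤ n, ∀ p ∈ S,
    ‖iteratedFDerivWithin ℝ i f S p‖ ≤ C * |p.2| ^ (r - i)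

variable {σ r t : ℝ} {n : ℕ} {S : Set (E × ℝ)} {f g : E × ℝ → H}

theorem IsOneSided.abs_pos (hS : IsOneSided σ S) {p : E × ℝ} (hp : p ∈ S) : 0 < |p.2| :=
  _root_.abs_pos.2 (hS.ne_zero p hp)

theorem HasWeight.mono (hS : IsOneSided σ S) (hf : HasWeight r n S f) (h : t ≤ r) :
    HasWeight t n S f := by
  obtain ⟨hc, C, hC, hb⟩ := hf
  refine ⟨hc, C, hC, fun i hi p hp => (hb i hi p hp).trans ?_⟩
  exact mul_le_mul_of_nonneg_left (Real.rpow_le_rpow_of_exponent_ge (hS.abs_pos hp)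
    (hS.abs_le_one p hp) (by linarith)) hC

theorem HasWeight.of_le {m : ℕ} (hf : HasWeight r n S f) (h : m ≤ n) : HasWeight r m S f := by
  obtain ⟨hc, C, hC, hb⟩ := hf
  exact ⟨hc.of_le (by exact_mod_cast h), C, hC, fun i hi p hp => hb i (hi.trans h) p hp⟩

theorem HasWeight.congr (hf : HasWeight r n S f) (h : EqOn g f S) : HasWeight r n S g := by
  obtain ⟨hc, C, hC, hb⟩ := hf
  refine ⟨hc.congr h, C, hC, fun i hi p hp => ?_⟩
  rw [iteratedFDerivWithin_congr h hp]
  exact hb i hi p hp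

theorem HasWeight.norm_le (hf : HasWeight r n S f) :
    ∃ C : ℝ, 0 ≤ C ∧ ∀ p ∈ S, ‖f p‖ ≤ C * |p.2| ^ r := by
  obtain ⟨hc, C, hC, hb⟩ := hf
  refine ⟨C, hC, fun p hp => ?_⟩
  simpa using hb 0 (Nat.zero_le _) p hp

theorem HasWeight.exists_norm_le (hf : HasWeight 0 n S f) :
    ∃ C : ℝ, ∀ p ∈ S, ‖f p‖ ≤ C := by
  obtain ⟨C, hC, hb⟩ := hf.norm_le
  exact ⟨C, fun p hp => by simpa using hb p hp⟩

theorem hasWeight_const (hS : IsOneSided σ S) (c : H) : HasWeight 0 n S (fun _ => c) := by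
  refine ⟨contDiffOn_const, ‖c‖, norm_nonneg _, fun i hi p hp => ?_⟩
  have := hS.abs_pos hp
  rcases Nat.eq_zero_or_pos i with rfl | h
  · simp
  · rw [iteratedFDerivWithin_const_of_ne h.ne']
    simp only [Pi.zero_apply, norm_zero]
    positivity

theorem HasWeight.add (hS : IsOneSided σ S) (hf : HasWeight r n S f) (hg : HasWeight r n S g) :
    HasWeight r n S (fun p => f p + g p) := by
  obtain ⟨hc, C, hC, hb⟩ := hf
  obtain ⟨hc', C', hC', hb'⟩ := hg
  refine ⟨hc.add hc', C + C', by positivity, fun i hi p hp => ?_⟩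
  have hi' : (i : WithTop ℕ∞) ≤ n := by exact_mod_cast hi
  have hadd : iteratedFDerivWithin ℝ i (fun p => f p + g p) S p = _ :=
    iteratedFDerivWithin_add_apply ((hc p hp).of_le hi') ((hc' p hp).of_le hi') hS.uniqueDiffOn hp
  rw [hadd, add_mul]
  exact (norm_add_le _ _).trans (add_le_add (hb i hi p hp) (hb' i hi p hp))

theorem HasWeight.clm_comp (hS : IsOneSided σ S) (hf : HasWeight r n S f) (Λ : H →L[ℝ] H') :
    HasWeight r n S (fun p => Λ (f p)) := by
  obtain ⟨hc, C, hC, hb⟩ := hf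
  refine ⟨Λ.contDiff.comp_contDiffOn hc, ‖Λ‖ * C, by positivity, fun i hi p hp => ?_⟩
  refine (Λ.norm_iteratedFDerivWithin_comp_left (hc p hp) hS.uniqueDiffOn hp
    (by exact_mod_cast hi)).trans ?_
  rw [mul_assoc]
  gcongr
  exact hb i hi p hp

theorem HasWeight.neg (hS : IsOneSided σ S) (hf : HasWeight r n S f) :
    HasWeight r n S (fun p => -f p) :=
  hf.clm_comp hS (-ContinuousLinearMap.id ℝ H)

theorem HasWeight.sub (hS : IsOneSided σ S) (hf : HasWeight r n S f) (hg : HasWeight r n S g) :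
    HasWeight r n S (fun p => f p - g p) := by
  simpa only [sub_eq_add_neg] using hf.add hS (hg.neg hS)

/-- Weights add up under bilinear products. -/
theorem HasWeight.bilinear (hS : IsOneSided σ S) (Λ : H →L[ℝ] H' →L[ℝ] H'') {g : E × ℝ → H'}
    (hf : HasWeight r n S f) (hg : HasWeight t n S g) :
    HasWeight (r + t) n S (fun p => Λ (f p) (g p)) := by
  obtain ⟨hc, C, hC, hb⟩ := hf
  obtain ⟨hc', C', hC', hb'⟩ := hg
  refine ⟨Λ.isBoundedBilinearMap.contDiff.comp_contDiffOn (hc.prodMk hc'),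
    ‖Λ‖ * (2 ^ n * (C * C')), by positivity, fun i hi p hp => ?_⟩
  have hp0 := hS.abs_pos hp
  refine (Λ.norm_iteratedFDerivWithin_le_of_bilinear hc hc' hS.uniqueDiffOn hp
    (by exact_mod_cast hi)).trans ?_
  rw [mul_assoc]
  refine mul_le_mul_of_nonneg_left ?_ (norm_nonneg Λ)
  calc ∑ j ∈ Finset.range (i + 1), (i.choose j : ℝ) * ‖iteratedFDerivWithin ℝ j f S p‖ *
        ‖iteratedFDerivWithin ℝ (i - j) g S p‖
      ≤ ∑ j ∈ Finset.range (i + 1), (i.choose j : ℝ) * (C * C' * |p.2| ^ (r + t - i)) := by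
        refine Finset.sum_le_sum fun j hj => ?_
        have hj' : j ≤ i := Nat.lt_succ_iff.1 (Finset.mem_range.1 hj)
        rw [mul_assoc]
        refine mul_le_mul_of_nonneg_left ?_ (Nat.cast_nonneg _)
        calc _ ≤ (C * |p.2| ^ (r - j)) * (C' * |p.2| ^ (t - (i - j : ℕ))) :=
              mul_le_mul (hb j (hj'.trans hi) p hp) (hb' (i - j) ((Nat.sub_le _ _).trans hi) p hp)
                (norm_nonneg _) (by positivity)
          _ = C * C' * (|p.2| ^ (r - j) * |p.2| ^ (t - (i - j : ℕ))) := by ring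
          _ = _ := by
              rw [← Real.rpow_add hp0, Nat.cast_sub hj']
              congr 2
              ring
    _ = 2 ^ i * (C * C') * |p.2| ^ (r + t - i) := by
        rw [← Finset.sum_mul, ← Nat.cast_sum, Nat.sum_range_choose]
        push_cast
        ring
    _ ≤ 2 ^ n * (C * C') * |p.2| ^ (r + t - i) := by
        gcongr
        norm_num

theorem HasWeight.smul (hS : IsOneSided σ S) {f : E × ℝ → ℝ}
    (hf : HasWeight r n S f) (hg : HasWeight t n S g) :
    HasWeight (r + t) n S (fun p => f p • g p) :=
  hf.bilinear hS (ContinuousLinearMap.lsmul ℝ ℝ) hg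

/-- Composition with a function whose derivatives are bounded along the image preserves
weight `0`: by Faà di Bruno, `‖D^i (h ∘ f)‖ = O((1/|y|)^i)`. -/
theorem HasWeight.comp (hS : IsOneSided σ S) (hf : HasWeight 0 n S f) {h : H → H'} {Q : Set H}
    (hQ : UniqueDiffOn ℝ Q) (hh : ContDiffOn ℝ (n : WithTop ℕ∞) h Q) (hfQ : MapsTo f S Q)
    (hb : ∀ i ≤ n, ∃ C : ℝ, ∀ p ∈ S, ‖iteratedFDerivWithin ℝ i h Q (f p)‖ ≤ C) :
    HasWeight 0 n S (fun p => h (f p)) := by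
  obtain ⟨hc, C, hC, hb'⟩ := hf
  choose! M hM using hb
  set M' : ℝ := ∑ i ∈ Finset.range (n + 1), |M i| with hM'
  have hMM : ∀ i ≤ n, M i ≤ M' := fun i hi =>
    (le_abs_self _).trans (Finset.single_le_sum (f := fun i => |M i|) (fun _ _ => abs_nonneg _)
      (Finset.mem_range.2 (Nat.lt_succ_of_le hi)))
  have hM0 : 0 ≤ M' := Finset.sum_nonneg fun _ _ => abs_nonneg _
  refine ⟨hh.comp hc hfQ, n.factorial * M' * (C + 1) ^ n, by positivity, fun i hi p hp => ?_⟩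
  have hp0 := hS.abs_pos hp
  have hi' : (i : WithTop ℕ∞) ≤ n := by exact_mod_cast hi
  have key := norm_iteratedFDerivWithin_comp_le (D := (C + 1) * |p.2|⁻¹) hh hc hi' hQ
    hS.uniqueDiffOn hfQ hp (fun j hj => (hM j (hj.trans hi) p hp).trans (hMM j (hj.trans hi))) ?_
  · refine key.trans ?_
    have hpow : |p.2| ^ ((0 : ℝ) - i) = |p.2|⁻¹ ^ i := by
      rw [zero_sub, Real.rpow_neg hp0.le, Real.rpow_natCast, inv_pow]
    rw [hpow, mul_pow, ← mul_assoc]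
    gcongr
    linarith
  · intro j hj1 hj
    refine (hb' j (hj.trans hi) p hp).trans ?_
    rw [zero_sub, Real.rpow_neg hp0.le, Real.rpow_natCast, mul_pow, inv_pow]
    gcongr
    calc C ≤ C + 1 := by linarith
      _ ≤ (C + 1) ^ j := le_self_pow₀ (by linarith) (by omega)

theorem HasWeight.inv (hS : IsOneSided σ S) {f : E × ℝ → ℝ} (hf : HasWeight 0 n S f) {c : ℝ}
    (hc : 0 < c) (hfc : ∀ p ∈ S, c ≤ |f p|) : HasWeight 0 n S (fun p => (f p)⁻¹) := by
  obtain ⟨M, hM⟩ := hf.exists_norm_le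
  have hcd : ContDiffOn ℝ (n : WithTop ℕ∞) (fun x : ℝ => x⁻¹) {0}ᶜ := fun x hx =>
    (contDiffAt_inv ℝ hx).contDiffWithinAt
  have hU : UniqueDiffOn ℝ ({0}ᶜ : Set ℝ) := isOpen_compl_singleton.uniqueDiffOn
  have h0 : ∀ p ∈ S, f p ≠ 0 := fun p hp => abs_pos.1 (hc.trans_le (hfc p hp))
  refine hf.comp hS hU hcd (fun p hp => h0 p hp) fun i hi => ?_
  -- The values of `f` lie in the compact set `{c ≤ |x| ≤ M}`, away from the pole of the inverse.
  have hK : IsCompact (Metric.closedBall (0 : ℝ) M ∩ {x | c ≤ |x|}) :=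
    (isCompact_closedBall _ _).inter_right (isClosed_le continuous_const continuous_abs)
  obtain ⟨C, hC⟩ := hK.exists_bound_of_continuousOn
    ((hcd.continuousOn_iteratedFDerivWithin (m := i) (by exact_mod_cast hi) hU).mono
      (fun x hx => abs_pos.1 (hc.trans_le hx.2)))
  exact ⟨C, fun p hp => hC _ ⟨by simpa using hM p hp, hfc p hp⟩⟩

/-- Weights can be checked on the first derivative. -/
theorem HasWeight.succ_of_fderivWithin (hS : IsOneSided σ S) (hd : DifferentiableOn ℝ f S) {C : ℝ}
    (hb : ∀ p ∈ S, ‖f p‖ ≤ C * |p.2| ^ r)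
    (hf : HasWeight (r - 1) n S (fderivWithin ℝ f S)) : HasWeight r (n + 1) S f := by
  obtain ⟨hc, C', hC', hb'⟩ := hf
  refine ⟨?_, max C C', le_max_of_le_right hC', fun i hi p hp => ?_⟩
  · push_cast
    rw [contDiffOn_succ_iff_fderivWithin hS.uniqueDiffOn]
    exact ⟨hd, by simp, hc⟩
  · have hp0 := hS.abs_pos hp
    cases i with
    | zero =>
      simp only [norm_iteratedFDerivWithin_zero, Nat.cast_zero, sub_zero]
      refine (hb p hp).trans ?_
      gcongr
      exact le_max_left _ _
    | succ i =>
      rw [← norm_iteratedFDerivWithin_fderivWithin hS.uniqueDiffOn hp]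
      refine (hb' i (by omega) p hp).trans ?_
      have : r - 1 - i = r - (i + 1 : ℕ) := by push_cast; ring
      rw [this]
      gcongr
      exact le_max_right _ _

theorem IsOneSided.hasFDerivWithinAt_rpow (hS : IsOneSided σ S) (r : ℝ) {p : E × ℝ} (hp : p ∈ S) :
    HasFDerivWithinAt (fun q : E × ℝ => |q.2| ^ r)
      ((σ * r * |p.2| ^ (r - 1)) • ContinuousLinearMap.snd ℝ E ℝ) S p := by
  have h1 : HasFDerivAt (fun q : E × ℝ => σ * q.2) (σ • ContinuousLinearMap.snd ℝ E ℝ) p :=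
    (ContinuousLinearMap.snd ℝ E ℝ).hasFDerivAt.const_mul σ
  have hne : σ * p.2 ≠ 0 := by rw [← hS.abs_eq p hp]; exact (hS.abs_pos hp).ne'
  have h2 := (h1.rpow_const (p := r) (Or.inl hne)).hasFDerivWithinAt (s := S)
  have h3 := h2.congr (f₁ := fun q : E × ℝ => |q.2| ^ r) (fun q hq => by simp only [hS.abs_eq q hq])
    (by simp only [hS.abs_eq p hp])
  rw [smul_smul, ← hS.abs_eq p hp] at h3
  have e : r * |p.2| ^ (r - 1) * σ = σ * r * |p.2| ^ (r - 1) := by ring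
  rwa [e] at h3

theorem hasWeight_rpow (hS : IsOneSided σ S) (r : ℝ) (n : ℕ) :
    HasWeight r n S (fun p => |p.2| ^ r) := by
  induction n generalizing r with
  | zero =>
    refine ⟨?_, 1, zero_le_one, fun i hi p hp => ?_⟩
    · rw [Nat.cast_zero, contDiffOn_zero]
      exact fun p hp => (hS.hasFDerivWithinAt_rpow r hp).continuousWithinAt
    · obtain rfl : i = 0 := by omega
      simp [abs_of_nonneg (Real.rpow_nonneg (abs_nonneg p.2) r)]
  | succ n ih =>
    refine HasWeight.succ_of_fderivWithin (C := 1) hS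
      (fun p hp => (hS.hasFDerivWithinAt_rpow r hp).differentiableWithinAt) (fun p hp => ?_) ?_
    · simp [abs_of_nonneg (Real.rpow_nonneg (abs_nonneg p.2) r)]
    · refine ((ih (r - 1)).clm_comp hS ((σ * r) • (ContinuousLinearMap.id ℝ ℝ).smulRight
        (ContinuousLinearMap.snd ℝ E ℝ))).congr fun p hp => ?_
      rw [(hS.hasFDerivWithinAt_rpow r hp).fderivWithin (hS.uniqueDiffOn p hp)]
      simp [smul_smul]

theorem HasWeight.rpow_smul (hS : IsOneSided σ S) (hf : HasWeight t n S f) (r : ℝ) :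
    HasWeight (r + t) n S (fun p => |p.2| ^ r • f p) :=
  (hasWeight_rpow hS r n).smul hS hf

end Weights

section MixedPartialWeights

variable {E : Type*} [NormedAddCommGroup E] [NormedSpace ℝ E]
  {H : Type*} [NormedAddCommGroup H] [NormedSpace ℝ H]
  {σ γ K : ℝ} {k : ℕ} {S : Set (E × ℝ)} {f : E × ℝ → H}

theorem PartialsBounded.hasWeight (hS : IsOneSided σ S) (hK : 0 ≤ K)
    (hf : PartialsBounded k γ K S f) : HasWeight γ (k + 1) S f := by
  refine ⟨hf.1, 2 ^ (k + 1) * K, by positivity, fun i hi p hp => ?_⟩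
  have hp0 := hS.abs_pos hp
  refine ContinuousMultilinearMap.opNorm_le_bound (by positivity) fun w => ?_
  refine (norm_multilinear_le_of_piecewise (M := K * |p.2| ^ (γ - i)) _ w fun s => ?_).trans ?_
  · refine (norm_iteratedFDerivWithin_piecewise_le hf hS.uniqueDiffOn hS.subset_closure_interior
      hi hp s w).trans ?_
    have hs : (s.card : ℝ) ≤ i := by exact_mod_cast (by simpa using s.card_le_univ)
    refine mul_le_mul (mul_le_mul_of_nonneg_left (Real.rpow_le_rpow_of_exponent_ge hp0
      (hS.abs_le_one p hp) (by linarith)) hK) (prod_norm_piecewise_le s w)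
      (Finset.prod_nonneg fun _ _ => norm_nonneg _) (by positivity)
  · rw [mul_assoc (2 ^ (k + 1))]
    gcongr
    norm_num

/-- Horizontal derivatives lose no weight, since the last of the `i + 1` directions in
`D^i (∂ₓ f)` is horizontal. -/
theorem PartialsBounded.hasWeight_fderivWithin_inl (hS : IsOneSided σ S) (hK : 0 ≤ K)
    (hf : PartialsBounded k γ K S f) :
    HasWeight γ k S (fun p => (fderivWithin ℝ f S p).comp (ContinuousLinearMap.inl ℝ E ℝ)) := by
  have hcd : ContDiffOn ℝ (k : WithTop ℕ∞) (fderivWithin ℝ f S) S :=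
    hf.1.fderivWithin hS.uniqueDiffOn (by norm_cast)
  let Λ : (E × ℝ →L[ℝ] H) →L[ℝ] (E →L[ℝ] H) :=
    (ContinuousLinearMap.compL ℝ E (E × ℝ) H).flip (ContinuousLinearMap.inl ℝ E ℝ)
  have hΛ : (fun p => (fderivWithin ℝ f S p).comp (ContinuousLinearMap.inl ℝ E ℝ)) =
      Λ ∘ fderivWithin ℝ f S := rfl
  refine ⟨hΛ ▸ Λ.contDiff.comp_contDiffOn hcd, 2 ^ (k + 1) * K, by positivity,
    fun i hi p hp => ?_⟩
  have hp0 := hS.abs_pos hp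
  rw [hΛ, Λ.iteratedFDerivWithin_comp_left (hcd p hp) hS.uniqueDiffOn hp (by exact_mod_cast hi)]
  refine ContinuousMultilinearMap.opNorm_le_bound (by positivity) fun w => ?_
  refine ContinuousLinearMap.opNorm_le_bound _ (by positivity) fun v => ?_
  let u : Fin (i + 1) → E × ℝ := Fin.snoc (α := fun _ => E × ℝ) w (v, 0)
  have hu : (Λ.compContinuousMultilinearMap (iteratedFDerivWithin ℝ i (fderivWithin ℝ f S) S p)) w v
      = iteratedFDerivWithin ℝ (i + 1) f S p u := by
    rw [iteratedFDerivWithin_succ_apply_right hS.uniqueDiffOn hp]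
    simp [u, Λ]
  have hprod : ∏ j, ‖u j‖ = (∏ j, ‖w j‖) * ‖v‖ := by
    simp [u, Fin.prod_univ_castSucc, Prod.norm_def]
  rw [hu]
  refine (norm_multilinear_le_of_piecewise (M := K * |p.2| ^ (γ - i)) _ u fun s => ?_).trans ?_
  · by_cases hs : Fin.last i ∈ s
    · rw [ContinuousMultilinearMap.map_coord_zero _ (Fin.last i)]
      · rw [norm_zero]
        positivity
      · simp [hs, u]
    · refine (norm_iteratedFDerivWithin_piecewise_le hf hS.uniqueDiffOn
        hS.subset_closure_interior (by omega) hp s u).trans ?_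
      have hs : (s.card : ℝ) ≤ i := by
        have : s.card < i + 1 := by
          simpa using Finset.card_lt_univ_of_notMem hs
        exact_mod_cast Nat.lt_succ_iff.1 this
      refine mul_le_mul (mul_le_mul_of_nonneg_left (Real.rpow_le_rpow_of_exponent_ge hp0
        (hS.abs_le_one p hp) (by linarith)) hK) (prod_norm_piecewise_le s u)
        (Finset.prod_nonneg fun _ _ => norm_nonneg _) (by positivity)
  · rw [hprod]
    calc 2 ^ (i + 1) * (K * |p.2| ^ (γ - i)) * ((∏ j, ‖w j‖) * ‖v‖)
        ≤ 2 ^ (k + 1) * (K * |p.2| ^ (γ - i)) * ((∏ j, ‖w j‖) * ‖v‖) := by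
          gcongr
          norm_num
      _ = _ := by ring

theorem HasWeight.fderivWithin_apply (hS : IsOneSided σ S) (hf : HasWeight γ (k + 1) S f)
    (v : E × ℝ) : HasWeight (γ - 1) k S (fun p => fderivWithin ℝ f S p v) := by
  have : HasWeight (γ - 1) k S (fderivWithin ℝ f S) := by
    obtain ⟨hc, C, hC, hb⟩ := hf
    refine ⟨hc.fderivWithin hS.uniqueDiffOn (by norm_cast), C, hC, fun i hi p hp => ?_⟩
    rw [norm_iteratedFDerivWithin_fderivWithin hS.uniqueDiffOn hp]
    convert hb (i + 1) (by omega) p hp using 3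
    push_cast
    ring
  exact this.clm_comp hS (ContinuousLinearMap.apply ℝ H v)

end MixedPartialWeights

/-! ### The domain and its one-sided strips -/

section Geometry

variable {E : Type*} [NormedAddCommGroup E]

/-- The part of `D` on the side of `D₀` given by the sign `σ = ±1`, at height less than `δ`. -/
def strip (E : Type*) [NormedAddCommGroup E] (σ δ : ℝ) : Set (E × ℝ) :=
  {p | p ∈ dom E ∧ 0 < σ * p.2 ∧ σ * p.2 < δ}

theorem domStar_eq : domStar E = dom E ∩ {p | p.2 ≠ 0} := by
  ext p
  simp only [domStar, domNeg, domPos, mem_union, mem_ofPred_eq, mem_inter_iff, ne_iff_lt_or_gt]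
  tauto

theorem isOpen_ne_zero : IsOpen {p : E × ℝ | p.2 ≠ 0} :=
  isOpen_ne_fun continuous_snd continuous_const

variable [NormedSpace ℝ E]

theorem convex_dom : Convex ℝ (dom E) := by
  have : dom E = Metric.closedBall (0 : E) 1 ×ˢ Metric.closedBall (0 : ℝ) 1 := by
    ext p
    simp [dom]
  rw [this]
  exact (convex_closedBall _ _).prod (convex_closedBall _ _)

theorem isCompact_dom [FiniteDimensional ℝ E] : IsCompact (dom E) := by
  have : dom E = Metric.closedBall (0 : E) 1 ×ˢ Metric.closedBall (0 : ℝ) 1 := by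
    ext p
    simp [dom]
  rw [this]
  have := FiniteDimensional.proper_real E
  exact (isCompact_closedBall _ _).prod (isCompact_closedBall _ _)

omit [NormedSpace ℝ E] in
theorem strip_interior_nonempty {σ δ : ℝ} (hσ : |σ| = 1) (hδ : 0 < δ) :
    (interior (strip E σ δ)).Nonempty := by
  have hσ2 : σ * σ = 1 := by rw [← abs_mul_abs_self, hσ, one_mul]
  have hO : IsOpen {p : E × ℝ | ‖p.1‖ < 1 ∧ |p.2| < 1 ∧ 0 < σ * p.2 ∧ σ * p.2 < δ} :=
    (isOpen_lt continuous_fst.norm continuous_const).inter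
      ((isOpen_lt continuous_snd.abs continuous_const).inter
        ((isOpen_lt continuous_const (continuous_const.mul continuous_snd)).inter
          (isOpen_lt (continuous_const.mul continuous_snd) continuous_const)))
  refine ⟨(0, σ * (min δ 1 / 2)), mem_interior.2 ⟨_, ?_, hO, ?_⟩⟩
  · exact fun p hp => ⟨⟨hp.1.le, hp.2.1.le⟩, hp.2.2⟩
  · have h1 : 0 < min δ 1 := lt_min hδ one_pos
    have h2 := min_le_left δ 1
    have h3 := min_le_right δ 1
    refine ⟨by simp, ?_, ?_, ?_⟩
    · rw [abs_mul, hσ, abs_of_pos (by positivity)]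
      linarith
    · rw [← mul_assoc, hσ2]
      linarith
    · rw [← mul_assoc, hσ2]
      linarith

theorem strip_convex (σ δ : ℝ) : Convex ℝ (strip E σ δ) := by
  have hl : IsLinearMap ℝ (fun p : E × ℝ => σ * p.2) :=
    (σ • LinearMap.snd ℝ E ℝ).isLinear
  exact convex_dom.inter ((convex_halfSpace_gt hl 0).inter (convex_halfSpace_lt hl δ))

theorem uniqueDiffOn_dom : UniqueDiffOn ℝ (dom E) :=
  uniqueDiffOn_convex convex_dom ((strip_interior_nonempty abs_one one_pos).mono
    (interior_mono fun _ hp => hp.1))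

theorem uniqueDiffOn_domStar : UniqueDiffOn ℝ (domStar E) := by
  rw [domStar_eq]
  exact uniqueDiffOn_dom.inter isOpen_ne_zero

theorem isOneSided_strip {σ δ : ℝ} (hσ : |σ| = 1) (hδ : 0 < δ) : IsOneSided σ (strip E σ δ) where
  uniqueDiffOn := uniqueDiffOn_convex (strip_convex σ δ) (strip_interior_nonempty hσ hδ)
  subset_closure_interior := by
    rw [(strip_convex σ δ).closure_interior_eq_closure_of_nonempty_interior
      (strip_interior_nonempty hσ hδ)]
    exact subset_closure
  ne_zero p hp h := by
    have := hp.2.1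
    simp [h] at this
  abs_le_one p hp := hp.1.2
  abs_eq p hp := by
    rw [← abs_of_pos hp.2.1, abs_mul, hσ, one_mul]

omit [NormedSpace ℝ E] in
theorem strip_eq_domStar_inter (σ δ : ℝ) :
    strip E σ δ = domStar E ∩ {p | 0 < σ * p.2 ∧ σ * p.2 < δ} := by
  rw [domStar_eq]
  ext p
  simp only [strip, mem_ofPred_eq, mem_inter_iff]
  refine ⟨fun h => ⟨⟨h.1, fun h0 => ?_⟩, h.2⟩, fun h => ⟨h.1.1, h.2⟩⟩
  have := h.2.1
  simp [h0] at this

omit [NormedSpace ℝ E] in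
theorem isOpen_band (σ δ : ℝ) : IsOpen {p : E × ℝ | 0 < σ * p.2 ∧ σ * p.2 < δ} :=
  (isOpen_lt continuous_const (continuous_const.mul continuous_snd)).inter
    (isOpen_lt (continuous_const.mul continuous_snd) continuous_const)

omit [NormedSpace ℝ E] in
theorem strip_subset_domStar (σ δ : ℝ) : strip E σ δ ⊆ domStar E := by
  rw [strip_eq_domStar_inter]
  exact inter_subset_left

theorem fderivWithin_domStar_eq {H : Type*} [NormedAddCommGroup H] [NormedSpace ℝ H]
    {σ δ : ℝ} (f : E × ℝ → H) {p : E × ℝ} (hp : p ∈ strip E σ δ) :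
    fderivWithin ℝ f (domStar E) p = fderivWithin ℝ f (strip E σ δ) p := by
  rw [strip_eq_domStar_inter, fderivWithin_inter ((isOpen_band σ δ).mem_nhds hp.2)]

theorem iteratedFDerivWithin_domStar_eq {H : Type*} [NormedAddCommGroup H] [NormedSpace ℝ H]
    {σ δ : ℝ} (f : E × ℝ → H) (i : ℕ) {p : E × ℝ} (hp : p ∈ strip E σ δ) :
    iteratedFDerivWithin ℝ i f (domStar E) p = iteratedFDerivWithin ℝ i f (strip E σ δ) p := by
  rw [strip_eq_domStar_inter] at hp ⊢
  rw [iteratedFDerivWithin_inter_open (isOpen_band σ δ) hp.2]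

/-- By compactness, a neighbourhood of `D₀` contains all points of `D` of small height. -/
theorem exists_height_subset [FiniteDimensional ℝ E] {U : Set (E × ℝ)} (hU : IsOpen U)
    (h : domZero E ⊆ U) : ∃ δ > 0, ∀ p ∈ dom E, |p.2| < δ → p ∈ U := by
  obtain ⟨δ, hδ, hb⟩ := (isCompact_dom.diff hU).exists_forall_le' (f := fun p : E × ℝ => |p.2|)
    (continuous_snd.abs.continuousOn) (a := 0) (fun p hp => abs_pos.2 fun h0 => hp.2 (h ⟨hp.1, h0⟩))
  exact ⟨δ, hδ, fun p hp hlt => by_contra fun hn => (hb p ⟨hp, hn⟩).not_gt hlt⟩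

end Geometry

/-! ### Weights of `T`, `A`, `B`, `C` near `D₀` -/

section NormalForm

variable {E : Type*} [NormedAddCommGroup E] [NormedSpace ℝ E]
  {H : Type*} [NormedAddCommGroup H] [NormedSpace ℝ H]
  {k : ℕ} {α γ K σ δ : ℝ} {S : Set (E × ℝ)} {T : E × ℝ → E × ℝ}

theorem PartialsBounded.inter {f : E × ℝ → H} (hf : PartialsBounded k γ K S f) {V : Set (E × ℝ)}
    (hV : IsOpen V) : PartialsBounded k γ K (S ∩ V) f := by
  refine ⟨hf.1.mono inter_subset_left, fun l m hlm p hp v => ?_⟩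
  rw [mixedPartial, iteratedFDerivWithin_inter_open hV hp.2]
  exact hf.2 l m hlm p hp.1 v

theorem NormalFormOn.inter (h : NormalFormOn k α γ K T S) {V : Set (E × ℝ)} (hV : IsOpen V) :
    NormalFormOn k α γ K T (S ∩ V) := by
  obtain ⟨xs, Bs, ys, As, φ, ψ, hA, hφ, hψ, heq⟩ := h
  exact ⟨xs, Bs, ys, As, φ, ψ, hA, hφ.inter hV, hψ.inter hV, fun p hp => heq p hp.1⟩

omit [NormedSpace ℝ E] in
theorem strip_inter_band (σ : ℝ) {δ δ' : ℝ} (h : δ' ≤ δ) :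
    strip E σ δ ∩ {p | 0 < σ * p.2 ∧ σ * p.2 < δ'} = strip E σ δ' := by
  ext p
  simp only [strip, mem_inter_iff, mem_ofPred_eq]
  refine ⟨fun h => ⟨h.1.1, h.2⟩, fun h' => ⟨⟨h'.1, h'.2.1, h'.2.2.trans_le h⟩, h'.2⟩⟩

/-- For `f = c + |y|^α (b + φ)`, the vertical derivative within `S` is `|y|^{α-1}` times this
function, where `σ = ±1` is the sign of `y`. The factor `|y|` is a real power, like all weights. -/
noncomputable def verticalFactor (α σ : ℝ) (b : H) (φ : E × ℝ → H) (S : Set (E × ℝ)) (p : E × ℝ) : H :=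
  (σ * α) • (b + φ p) + |p.2| ^ (1 : ℝ) • fderivWithin ℝ φ S p (0, 1)

theorem fderivWithin_normalForm (hS : IsOneSided σ S) (c b : H) {φ f : E × ℝ → H}
    (hφ : DifferentiableOn ℝ φ S) (hf : ∀ p ∈ S, f p = c + |p.2| ^ α • (b + φ p)) {p : E × ℝ}
    (hp : p ∈ S) :
    (fderivWithin ℝ f S p).comp (ContinuousLinearMap.inl ℝ E ℝ) =
        |p.2| ^ (α - 1) • |p.2| ^ (1 : ℝ) •
          (fderivWithin ℝ φ S p).comp (ContinuousLinearMap.inl ℝ E ℝ) ∧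
      fderivWithin ℝ f S p (0, 1) = |p.2| ^ (α - 1) • verticalFactor α σ b φ S p := by
  have h1 := (hS.hasFDerivWithinAt_rpow α hp).smul ((hφ p hp).hasFDerivWithinAt.const_add b)
  have h2 : HasFDerivWithinAt f _ S p := (h1.const_add c).congr hf (hf p hp)
  have hpow : |p.2| ^ α = |p.2| ^ (α - 1) * |p.2| ^ (1 : ℝ) := by
    rw [← Real.rpow_add (hS.abs_pos hp)]
    ring_nf
  rw [h2.fderivWithin (hS.uniqueDiffOn p hp)]
  constructor
  · ext v
    simp [hpow, smul_smul]
  · simp only [verticalFactor, add_apply, smul_apply,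
      ContinuousLinearMap.smulRight_apply, ContinuousLinearMap.coe_snd', smul_add, hpow, smul_smul,
      smul_eq_mul, mul_one]
    rw [add_comm]
    ring_nf

theorem hasWeight_verticalFactor_sub (hS : IsOneSided σ S) (hK : 0 ≤ K)
    (b : H) {φ : E × ℝ → H} (hφ : PartialsBounded k γ K S φ) :
    HasWeight γ k S (fun p => verticalFactor α σ b φ S p - (σ * α) • b) := by
  have hw := hφ.hasWeight hS hK
  have h1 := (hw.of_le (Nat.le_succ k)).clm_comp hS ((σ * α) • ContinuousLinearMap.id ℝ H)
  have h2 := (hw.fderivWithin_apply hS (0, 1)).rpow_smul hS 1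
  rw [add_sub_cancel] at h2
  refine (h1.add hS h2).congr fun p _ => ?_
  simp [verticalFactor, smul_add]
  abel

theorem hasWeight_verticalFactor (hS : IsOneSided σ S) (hK : 0 ≤ K) (hγ : 0 ≤ γ)
    (b : H) {φ : E × ℝ → H} (hφ : PartialsBounded k γ K S φ) :
    HasWeight 0 k S (verticalFactor α σ b φ S) :=
  (((hasWeight_verticalFactor_sub (α := α) hS hK b hφ).mono hS hγ).add hS
    (hasWeight_const hS ((σ * α) • b))).congr fun p _ => by simp

theorem hasWeight_normalForm (hS : IsOneSided σ S) (hK : 0 ≤ K) (hγ : 0 ≤ γ) (hα : 0 ≤ α)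
    (c b : H) {φ f : E × ℝ → H} (hφ : PartialsBounded k γ K S φ)
    (hf : ∀ p ∈ S, f p = c + |p.2| ^ α • (b + φ p)) : HasWeight 0 k S f :=
  ((hasWeight_const hS c).add hS ((((hasWeight_const hS b).add hS
    (((hφ.hasWeight hS hK).of_le (Nat.le_succ k)).mono hS hγ)).rpow_smul hS α).mono hS
      (by linarith))).congr hf

/-- On a thin enough strip the factor of `∂_yG` is bounded away from zero, its limit at `D₀` being
`± α A* ≠ 0`. -/
theorem exists_verticalFactor_ge (hσ : |σ| = 1) (hδ : 0 < δ) (hK : 0 ≤ K) (hγ : 0 < γ) (hα : 0 < α)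
    {b : ℝ} (hb : b ≠ 0) {ψ : E × ℝ → ℝ} (hψ : PartialsBounded k γ K (strip E σ δ) ψ) :
    ∃ δ' > 0, δ' ≤ δ ∧ ∀ p ∈ strip E σ δ',
      α * |b| / 2 ≤ |verticalFactor α σ b ψ (strip E σ δ) p| := by
  have hS := isOneSided_strip (E := E) hσ hδ
  obtain ⟨C, hC, hbd⟩ := (hasWeight_verticalFactor_sub (α := α) hS hK b hψ).norm_le
  have hpos : 0 < α * |b| / 2 := by have := abs_pos.2 hb; positivity
  have hlim : Tendsto (fun x : ℝ => C * x ^ γ) (𝓝 0) (𝓝 0) := by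
    have := ((Real.continuousAt_rpow_const 0 γ (Or.inr hγ.le)).const_mul C).tendsto
    simpa [Real.zero_rpow hγ.ne'] using this
  obtain ⟨ε, hε, hball⟩ := Metric.eventually_nhds_iff.1 (hlim.eventually_lt_const hpos)
  refine ⟨min δ ε, lt_min hδ hε, min_le_left _ _, fun p hp => ?_⟩
  have hp' : p ∈ strip E σ δ := ⟨hp.1, hp.2.1, hp.2.2.trans_le (min_le_left _ _)⟩
  have hpε : |p.2| < ε := by
    rw [hS.abs_eq p hp']
    exact hp.2.2.trans_le (min_le_right _ _)
  have h1 := (hbd p hp').trans (hball (y := |p.2|) (by simpa using hpε)).le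
  have h2 : |(σ * α) • b| = α * |b| := by
    rw [smul_eq_mul, abs_mul, abs_mul, hσ, one_mul, abs_of_pos hα]
  have h3 := abs_sub_abs_le_abs_sub ((σ * α) • b) (verticalFactor α σ b ψ (strip E σ δ) p)
  rw [abs_sub_comm, h2] at h3
  rw [Real.norm_eq_abs] at h1
  linarith

/-- In `A`, `B`, `C` the factors `|y|^{α-1}` cancel. What remains of `∂ₓF` and `∂ₓG` is
`|y| ∂ₓφ` and `|y| ∂ₓψ`, of weight `γ + 1`, while `B` only has weight `0`. -/
theorem NormalFormOn.exists_hasWeight (h : NormalFormOn k α γ K T (strip E σ δ)) (hσ : |σ| = 1)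
    (hδ : 0 < δ) (hK : 0 ≤ K) (hγ : 0 < γ) (hα : 0 < α) :
    ∃ δ' > 0, HasWeight 0 k (strip E σ δ') T ∧ HasWeight (γ + 1) k (strip E σ δ') (matA T) ∧
      HasWeight 0 k (strip E σ δ') (colB T) ∧ HasWeight (γ + 1) k (strip E σ δ') (rowC T) := by
  obtain ⟨xs, Bs, ys, As, φ, ψ, hA, hφ, hψ, heq⟩ := h
  obtain ⟨δ', hδ', hle, hge⟩ := exists_verticalFactor_ge hσ hδ hK hγ hα hA hψ
  have hS := isOneSided_strip (E := E) hσ hδ'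
  have hsub : strip E σ δ' ⊆ strip E σ δ := by
    rw [← strip_inter_band σ hle]
    exact inter_subset_left
  have hfd : ∀ p ∈ strip E σ δ', fderivWithin ℝ ψ (strip E σ δ) p =
      fderivWithin ℝ ψ (strip E σ δ') p := fun p hp => by
    rw [← fderivWithin_domStar_eq ψ hp, ← fderivWithin_domStar_eq ψ (hsub hp)]
  replace hge : ∀ p ∈ strip E σ δ',
      α * |As| / 2 ≤ |verticalFactor α σ As ψ (strip E σ δ') p| := fun p hp => by
    have := hge p hp
    rwa [verticalFactor, hfd p hp] at this
  replace hφ : PartialsBounded k γ K (strip E σ δ') φ := by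
    rw [← strip_inter_band σ hle]
    exact hφ.inter (isOpen_band σ δ')
  replace hψ : PartialsBounded k γ K (strip E σ δ') ψ := by
    rw [← strip_inter_band σ hle]
    exact hψ.inter (isOpen_band σ δ')
  have hF : ∀ p ∈ strip E σ δ', (T p).1 = xs + |p.2| ^ α • (Bs + φ p) :=
    fun p hp => (heq p (hsub hp)).1
  have hG : ∀ p ∈ strip E σ δ', (T p).2 = ys + |p.2| ^ α • (As + ψ p) :=
    fun p hp => (heq p (hsub hp)).2
  have hpos : 0 < α * |As| / 2 := by have := abs_pos.2 hA; positivity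
  have hone : ((k + 1 : ℕ) : WithTop ℕ∞) ≠ 0 := by exact_mod_cast Nat.succ_ne_zero k
  have hφd := hφ.1.differentiableOn hone
  have hψd := hψ.1.differentiableOn hone
  have hginv := (hasWeight_verticalFactor (α := α) hS hK hγ.le As hψ).inv hS hpos hge
  have hdy : ∀ p ∈ strip E σ δ',
      dyG T p = |p.2| ^ (α - 1) * verticalFactor α σ As ψ (strip E σ δ') p := fun p hp => by
    rw [dyG, fderivWithin_domStar_eq _ hp]
    exact (fderivWithin_normalForm hS ys As hψd hG hp).2
  have hcancel : ∀ p ∈ strip E σ δ', (dyG T p)⁻¹ * |p.2| ^ (α - 1) =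
      (verticalFactor α σ As ψ (strip E σ δ') p)⁻¹ := fun p hp => by
    have hp0 : |p.2| ^ (α - 1) ≠ 0 := (Real.rpow_pos_of_pos (hS.abs_pos hp) _).ne'
    rw [hdy p hp, mul_inv, mul_right_comm, inv_mul_cancel₀ hp0, one_mul]
  refine ⟨δ', hδ', ?_, ?_, ?_, ?_⟩
  · refine (((hasWeight_normalForm hS hK hγ.le hα.le xs Bs hφ hF).clm_comp hS
      (ContinuousLinearMap.inl ℝ E ℝ)).add hS
      ((hasWeight_normalForm hS hK hγ.le hα.le ys As hψ hG).clm_comp hS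
      (ContinuousLinearMap.inr ℝ E ℝ))).congr fun p _ => ?_
    simp
  · have := hginv.smul hS ((hφ.hasWeight_fderivWithin_inl hS hK).rpow_smul hS 1)
    rw [zero_add, add_comm] at this
    refine this.congr fun p hp => ?_
    rw [matA, dxF, fderivWithin_domStar_eq _ hp,
      (fderivWithin_normalForm hS xs Bs hφd hF hp).1, smul_smul, hcancel p hp]
  · have := hginv.smul hS (hasWeight_verticalFactor (α := α) hS hK hγ.le Bs hφ)
    rw [zero_add] at this
    refine this.congr fun p hp => ?_
    rw [colB, dyF, fderivWithin_domStar_eq _ hp,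
      (fderivWithin_normalForm hS xs Bs hφd hF hp).2, smul_smul, hcancel p hp]
  · have := hginv.smul hS ((hψ.hasWeight_fderivWithin_inl hS hK).rpow_smul hS 1)
    rw [zero_add, add_comm] at this
    refine this.congr fun p hp => ?_
    rw [rowC, dxG, fderivWithin_domStar_eq _ hp,
      (fderivWithin_normalForm hS ys As hψd hG hp).1, smul_smul, hcancel p hp]

/-- Condition `(L₁)` as used below: weights of `T`, `A`, `B`, `C` on both sides of `D₀`. -/
theorem ConditionL1.exists_hasWeight [FiniteDimensional ℝ E] (hk : 1 ≤ k) (h : ConditionL1 k T) :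
    ∃ r : ℝ, k < r ∧ ∀ σ : ℝ, |σ| = 1 → ∃ δ > 0, HasWeight 0 k (strip E σ δ) T ∧
      HasWeight r k (strip E σ δ) (matA T) ∧ HasWeight 0 k (strip E σ δ) (colB T) ∧
      HasWeight r k (strip E σ δ) (rowC T) := by
  obtain ⟨U, α, γ, K, hU, hDU, hα, hγ, hK, hpos, hneg⟩ := h
  obtain ⟨δ, hδ, hsub⟩ := exists_height_subset hU hDU
  have hk' : (1 : ℝ) ≤ k := by exact_mod_cast hk
  refine ⟨γ + 1, by linarith, fun σ hσ => ?_⟩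
  suffices NormalFormOn k α γ K T (strip E σ δ) from
    this.exists_hasWeight hσ hδ hK.le (by linarith) hα
  rcases eq_or_eq_neg_of_abs_eq hσ with rfl | rfl
  · have : strip E 1 δ = (U ∩ domPos E) ∩ {p | 0 < 1 * p.2 ∧ 1 * p.2 < δ} := by
      ext p
      simp only [strip, domPos, mem_inter_iff, mem_ofPred_eq, one_mul]
      refine ⟨fun h => ⟨⟨hsub p h.1 ?_, h.1, h.2.1⟩, h.2⟩, fun h => ⟨h.1.2.1, h.2⟩⟩
      rw [abs_of_pos h.2.1]
      exact h.2.2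
    rw [this]
    exact hpos.inter (isOpen_band 1 δ)
  · have : strip E (-1) δ = (U ∩ domNeg E) ∩ {p | 0 < (-1) * p.2 ∧ (-1) * p.2 < δ} := by
      ext p
      simp only [strip, domNeg, mem_inter_iff, mem_ofPred_eq, neg_mul, one_mul]
      refine ⟨fun h => ⟨⟨hsub p h.1 ?_, h.1, by linarith [h.2.1]⟩, h.2⟩, fun h => ⟨h.1.2.1, h.2⟩⟩
      rw [abs_of_neg (by linarith [h.2.1])]
      exact h.2.2
    rw [this]
    exact hneg.inter (isOpen_band (-1) δ)

end NormalForm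

/-! ### Extension by zero across `D₀` -/

section Gluing

variable {E : Type*} [NormedAddCommGroup E] [NormedSpace ℝ E]
  {H : Type*} [NormedAddCommGroup H] [NormedSpace ℝ H]

omit [NormedSpace ℝ E] in
theorem tendsto_const_mul_abs_rpow {p : E × ℝ} (hp : p.2 = 0) (C : ℝ) {s : ℝ} (hs : 0 < s) :
    Tendsto (fun q : E × ℝ => C * |q.2| ^ s) (𝓝 p) (𝓝 0) := by
  have h : ContinuousAt (fun q : E × ℝ => C * |q.2| ^ s) p :=
    (continuous_snd.abs.continuousAt.rpow_const (Or.inr hs.le)).const_mul C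
  simpa [ContinuousAt, hp, Real.zero_rpow hs.ne'] using h

theorem hasFDerivWithinAt_zero_of_le {g : E × ℝ → H} {S : Set (E × ℝ)} {p : E × ℝ} (hp : p.2 = 0)
    (hg : g p = 0) {C s : ℝ} (hs : 1 < s) (hb : ∀ᶠ q in 𝓝[S] p, ‖g q‖ ≤ C * |q.2| ^ s) :
    HasFDerivWithinAt g (0 : E × ℝ →L[ℝ] H) S p := by
  refine HasFDerivWithinAt.of_isLittleO (Asymptotics.isLittleO_iff.2 fun c hc => ?_)
  have hlim := (tendsto_const_mul_abs_rpow hp C (sub_pos.2 hs)).eventually_lt_const hc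
  filter_upwards [hb, nhdsWithin_le_nhds hlim] with q hq hq'
  have h1 : |q.2| ≤ ‖q - p‖ := by
    have := norm_snd_le (q - p)
    simpa [hp] using this
  have h2 : |q.2| ^ s = |q.2| ^ (s - 1) * |q.2| := by
    rcases (abs_nonneg q.2).eq_or_lt with h | h
    · rw [← h, Real.zero_rpow (by linarith), mul_zero]
    · rw [← Real.rpow_add_one h.ne', sub_add_cancel]
  rw [hg]
  simp only [sub_zero, zero_apply]
  calc ‖g q‖ ≤ C * |q.2| ^ (s - 1) * |q.2| := by rw [mul_assoc, ← h2]; exact hq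
    _ ≤ c * ‖q - p‖ := by gcongr

/-- A `C^k` function on `D*` of weight larger than `k` on both sides of `D₀` and vanishing on `D₀`
is `C^k` on `D` and flat to order `k` on `D₀`: its derivatives extended by zero form a Taylor
series, because `‖D^i f‖ = O(|y|^s)` with `s > 1` for `i < k` and `s > 0` for `i = k`. -/
theorem contDiffOn_dom_of_hasWeight {f : E × ℝ → H} {k : ℕ} {r : ℝ}
    (hf : ContDiffOn ℝ (k : WithTop ℕ∞) f (domStar E)) (h0 : ∀ p ∈ domZero E, f p = 0)
    (hr : k < r) (hw : ∀ σ : ℝ, |σ| = 1 → ∃ δ > 0, HasWeight r k (strip E σ δ) f) :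
    ContDiffOn ℝ (k : WithTop ℕ∞) f (dom E) ∧
      ∀ i ≤ k, ∀ p ∈ domZero E, iteratedFDerivWithin ℝ i f (dom E) p = 0 := by
  classical
  let P : E × ℝ → FormalMultilinearSeries ℝ (E × ℝ) H := fun p i =>
    if p.2 = 0 then 0 else iteratedFDerivWithin ℝ i f (domStar E) p
  have hP0 : ∀ p : E × ℝ, p.2 = 0 → ∀ i, P p i = 0 := fun p hp i => by simp [P, hp]
  have hP1 : ∀ p : E × ℝ, p.2 ≠ 0 → ∀ i, P p i = iteratedFDerivWithin ℝ i f (domStar E) p :=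
    fun p hp i => by simp [P, hp]
  obtain ⟨δ, hδ, C, hC⟩ : ∃ δ > 0, ∃ C : ℝ, ∀ i ≤ k, ∀ p ∈ dom E, |p.2| < δ →
      ‖P p i‖ ≤ C * |p.2| ^ (r - i) := by
    obtain ⟨δ₁, hδ₁, -, C₁, hC₁, hb₁⟩ := hw 1 (by simp)
    obtain ⟨δ₂, hδ₂, -, C₂, hC₂, hb₂⟩ := hw (-1) (by simp)
    refine ⟨min δ₁ δ₂, lt_min hδ₁ hδ₂, max C₁ C₂, fun i hi p hp hlt => ?_⟩
    rcases lt_trichotomy p.2 0 with h | h | h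
    · have hps : p ∈ strip E (-1) δ₂ := by
        rw [abs_of_neg h] at hlt
        exact ⟨hp, by linarith, by linarith [hlt.trans_le (min_le_right δ₁ δ₂)]⟩
      have := hb₂ i hi p hps
      rw [← iteratedFDerivWithin_domStar_eq f i hps] at this
      rw [hP1 p h.ne]
      exact this.trans (by gcongr; exact le_max_right _ _)
    · rw [hP0 p h, norm_zero]
      have : 0 ≤ max C₁ C₂ := le_max_of_le_left hC₁
      positivity
    · have hps : p ∈ strip E 1 δ₁ := by
        rw [abs_of_pos h] at hlt
        exact ⟨hp, by linarith, by linarith [hlt.trans_le (min_le_left δ₁ δ₂)]⟩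
      have := hb₁ i hi p hps
      rw [← iteratedFDerivWithin_domStar_eq f i hps] at this
      rw [hP1 p h.ne']
      exact this.trans (by gcongr; exact le_max_left _ _)
  have hbd : ∀ i ≤ k, ∀ p : E × ℝ, p.2 = 0 →
      ∀ᶠ q in 𝓝[dom E] p, ‖P q i‖ ≤ C * |q.2| ^ (r - i) := fun i hi p hp => by
    have hlt : ∀ᶠ q : E × ℝ in 𝓝 p, |q.2| < δ :=
      continuous_snd.abs.continuousAt.eventually_lt_const (by simpa [hp] using hδ)
    filter_upwards [nhdsWithin_le_nhds hlt, self_mem_nhdsWithin] with q hq hqd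
    exact hC i hi q hqd hq
  have hnhds : ∀ p : E × ℝ, p.2 ≠ 0 → 𝓝[domStar E] p = 𝓝[dom E] p := fun p hp => by
    rw [domStar_eq]
    exact nhdsWithin_inter_of_mem' (nhdsWithin_le_nhds (isOpen_ne_zero.mem_nhds hp))
  have hPev : ∀ p : E × ℝ, p.2 ≠ 0 → ∀ i,
      (fun q => P q i) =ᶠ[𝓝 p] iteratedFDerivWithin ℝ i f (domStar E) := fun p hp i => by
    filter_upwards [isOpen_ne_zero.mem_nhds hp] with q hq using hP1 q hq i
  have hstar : ∀ p ∈ dom E, p.2 ≠ 0 → p ∈ domStar E := fun p hp h => by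
    rw [domStar_eq]; exact ⟨hp, h⟩
  have hft := hf.ftaylorSeriesWithin uniqueDiffOn_domStar
  have hTaylor : HasFTaylorSeriesUpToOn (k : WithTop ℕ∞) f P (dom E) := by
    refine ⟨fun p hp => ?_, fun m hm p hp => ?_, fun m hm p hp => ?_⟩
    · by_cases h : p.2 = 0
      · rw [hP0 p h, h0 p ⟨hp, h⟩]
        rfl
      · rw [hP1 p h]
        exact hft.zero_eq p (hstar p hp h)
    · have hm' : m + 1 ≤ k := Nat.succ_le_of_lt (by exact_mod_cast hm)
      by_cases h : p.2 = 0
      · rw [hP0 p h]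
        refine hasFDerivWithinAt_zero_of_le h (hP0 p h m) ?_ (hbd m (by omega) p h)
        have : ((m + 1 : ℕ) : ℝ) ≤ k := by exact_mod_cast hm'
        push_cast at this
        linarith
      · rw [hP1 p h]
        have h1 := hft.fderivWithin m hm p (hstar p hp h)
        rw [domStar_eq, hasFDerivWithinAt_inter (isOpen_ne_zero.mem_nhds h), ← domStar_eq] at h1
        exact h1.congr_of_eventuallyEq (nhdsWithin_le_nhds (hPev p h m)) (hP1 p h m)
    · have hm' : m ≤ k := by exact_mod_cast hm
      by_cases h : p.2 = 0
      · have hmr : (m : ℝ) ≤ k := by exact_mod_cast hm'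
        have hlim := (tendsto_const_mul_abs_rpow (p := p) h C (s := r - m) (by linarith)).mono_left
          (nhdsWithin_le_nhds (s := dom E))
        have := squeeze_zero_norm' (hbd m hm' p h) hlim
        rw [ContinuousWithinAt, hP0 p h]
        exact this
      · have h1 := hft.cont m hm p (hstar p hp h)
        rw [ContinuousWithinAt, hnhds p h] at h1
        exact ContinuousWithinAt.congr_of_eventuallyEq h1 (nhdsWithin_le_nhds (hPev p h m))
          (hP1 p h m)
  refine ⟨hTaylor.contDiffOn, fun i hi p hp => ?_⟩
  rw [← hTaylor.eq_iteratedFDerivWithin_of_uniqueDiffOn (by exact_mod_cast hi) uniqueDiffOn_dom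
    hp.1, hP0 p hp.2]

omit [NormedSpace ℝ H] in
/-- Away from `D₀` boundedness is compactness. -/
theorem bddAbove_norm_image_domStar [FiniteDimensional ℝ E] {f : E × ℝ → H}
    (hf : ContinuousOn f (domStar E))
    (hw : ∀ σ : ℝ, |σ| = 1 → ∃ δ > 0, ∃ C : ℝ, ∀ p ∈ strip E σ δ, ‖f p‖ ≤ C) :
    BddAbove ((fun p => ‖f p‖) '' domStar E) := by
  obtain ⟨δ₁, hδ₁, C₁, hC₁⟩ := hw 1 (by simp)
  obtain ⟨δ₂, hδ₂, C₂, hC₂⟩ := hw (-1) (by simp)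
  have hpos : 0 < min δ₁ δ₂ := lt_min hδ₁ hδ₂
  have hK : IsCompact (dom E ∩ {p | min δ₁ δ₂ ≤ |p.2|}) :=
    isCompact_dom.inter_right (isClosed_le continuous_const continuous_snd.abs)
  have hsub : dom E ∩ {p | min δ₁ δ₂ ≤ |p.2|} ⊆ domStar E := fun p hp => by
    rw [domStar_eq]
    exact ⟨hp.1, abs_pos.1 (hpos.trans_le hp.2)⟩
  obtain ⟨C, hC⟩ := hK.exists_bound_of_continuousOn (hf.mono hsub)
  refine ⟨max C (max C₁ C₂), ?_⟩
  rintro _ ⟨p, hp, rfl⟩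
  rcases le_or_gt (min δ₁ δ₂) |p.2| with h | h
  · rw [domStar_eq] at hp
    exact (hC p ⟨hp.1, h⟩).trans (le_max_left _ _)
  · refine le_trans ?_ (le_max_right _ _)
    rcases hp with hp | hp
    · rw [abs_of_neg hp.2] at h
      have := h.trans_le (min_le_right _ _)
      exact (hC₂ p ⟨hp.1, by linarith [hp.2], by linarith⟩).trans (le_max_right _ _)
    · rw [abs_of_pos hp.2] at h
      have := h.trans_le (min_le_left _ _)
      exact (hC₁ p ⟨hp.1, by linarith [hp.2], by linarith⟩).trans (le_max_left _ _)

end Gluing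

/-! ### The graph transform -/

section Transform

variable {E : Type*} [NormedAddCommGroup E] [NormedSpace ℝ E]
  {k : ℕ} {T : E × ℝ → E × ℝ} {μ : E × ℝ → (E →L[ℝ] ℝ)}

omit [NormedSpace ℝ E] in
theorem supNorm_nonneg {H : Type*} [NormedAddCommGroup H] (f : E × ℝ → H) : 0 ≤ supNorm f := by
  refine Real.sSup_nonneg ?_
  rintro _ ⟨p, -, rfl⟩
  exact norm_nonneg _

theorem IsLorenzTypeMap.contDiffOn_matA_colB_rowC (hT : IsLorenzTypeMap k T) :
    ContDiffOn ℝ (k : WithTop ℕ∞) (matA T) (domStar E) ∧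
      ContDiffOn ℝ (k : WithTop ℕ∞) (colB T) (domStar E) ∧
      ContDiffOn ℝ (k : WithTop ℕ∞) (rowC T) (domStar E) := by
  have hF : ContDiffOn ℝ (k : WithTop ℕ∞)
      (fderivWithin ℝ (fun q => (T q).1) (domStar E)) (domStar E) :=
    (contDiff_fst.comp_contDiffOn hT.contDiffOn).fderivWithin uniqueDiffOn_domStar (by norm_cast)
  have hG : ContDiffOn ℝ (k : WithTop ℕ∞)
      (fderivWithin ℝ (fun q => (T q).2) (domStar E)) (domStar E) :=
    (contDiff_snd.comp_contDiffOn hT.contDiffOn).fderivWithin uniqueDiffOn_domStar (by norm_cast)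
  have hinv : ContDiffOn ℝ (k : WithTop ℕ∞) (fun p => (dyG T p)⁻¹) (domStar E) :=
    (hG.clm_apply contDiffOn_const).inv hT.dyG_ne_zero
  exact ⟨hinv.smul (hF.clm_comp contDiffOn_const), hinv.smul (hF.clm_apply contDiffOn_const),
    hinv.smul (hG.clm_comp contDiffOn_const)⟩

theorem graphTransform_of_ne {p : E × ℝ} (hp : p.2 ≠ 0) : graphTransform T μ p =
    (1 - μ (T p) (colB T p))⁻¹ • ((μ (T p)).comp (matA T p) - rowC T p) := by
  rw [graphTransform, if_neg hp]

theorem contDiffOn_graphTransform (hT : IsLorenzTypeMap k T)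
    (hμk : ContDiffOn ℝ (k : WithTop ℕ∞) μ (dom E))
    (hne : ∀ p ∈ domStar E, 1 - μ (T p) (colB T p) ≠ 0) :
    ContDiffOn ℝ (k : WithTop ℕ∞) (graphTransform T μ) (domStar E) := by
  obtain ⟨hA, hB, hC⟩ := hT.contDiffOn_matA_colB_rowC
  have hμT : ContDiffOn ℝ (k : WithTop ℕ∞) (fun p => μ (T p)) (domStar E) :=
    hμk.comp (hT.contDiffOn.of_le (by norm_cast; omega)) hT.mapsTo
  refine (((contDiffOn_const (c := (1 : ℝ))).sub (hμT.clm_apply hB)).inv hne |>.smul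
    ((hμT.clm_comp hA).sub hC)).congr fun p hp => ?_
  rw [domStar_eq] at hp
  exact graphTransform_of_ne hp.2

/-- `μ ∘ T A - C` inherits the weight of `A` and `C`; the other factors only have weight `0`, since
`μ ∘ T` and `B` have derivatives of order `|y|^{-i}`. -/
theorem hasWeight_graphTransform [FiniteDimensional ℝ E] {σ δ r c : ℝ} (hσ : |σ| = 1) (hδ : 0 < δ)
    (hmaps : MapsTo T (domStar E) (dom E))
    (hμk : ContDiffOn ℝ (k : WithTop ℕ∞) μ (dom E)) (hc : 0 < c)
    (hge : ∀ p ∈ domStar E, c ≤ |1 - μ (T p) (colB T p)|)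
    (hTw : HasWeight 0 k (strip E σ δ) T) (hA : HasWeight r k (strip E σ δ) (matA T))
    (hB : HasWeight 0 k (strip E σ δ) (colB T)) (hC : HasWeight r k (strip E σ δ) (rowC T)) :
    HasWeight r k (strip E σ δ) (graphTransform T μ) := by
  have hS := isOneSided_strip (E := E) hσ hδ
  have hsub := strip_subset_domStar (E := E) σ δ
  have hμT : HasWeight 0 k (strip E σ δ) (fun p => μ (T p)) := by
    refine hTw.comp hS uniqueDiffOn_dom hμk (hmaps.mono_left hsub) fun i hi => ?_
    obtain ⟨M, hM⟩ := isCompact_dom.exists_bound_of_continuousOn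
      (hμk.continuousOn_iteratedFDerivWithin (m := i) (by exact_mod_cast hi) uniqueDiffOn_dom)
    exact ⟨M, fun p hp => hM _ (hmaps (hsub hp))⟩
  have h1 := hμT.bilinear hS (ContinuousLinearMap.id ℝ (E →L[ℝ] ℝ)) hB
  rw [add_zero] at h1
  have h2 := ((hasWeight_const hS (1 : ℝ)).sub hS h1).inv hS hc fun p hp => hge p (hsub hp)
  have h3 := hμT.bilinear hS (ContinuousLinearMap.compL ℝ E E ℝ) hA
  rw [zero_add] at h3
  have h4 := h2.smul hS (h3.sub hS hC)
  rw [zero_add] at h4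
  exact h4.congr fun p hp => graphTransform_of_ne (hS.ne_zero p hp)

/-- For `L` between the roots of `b s² - (1 - a) s + c`, the quadratic is nonpositive at `L`, and
`b L < 1`. With `s₀ = 1 - a + √Δ` one has `s₀² + 4bc = 2(1-a)s₀`, so that the product
`(s₀L - 2c)(s₀ - 2bL)` of nonnegative factors is `-2s₀` times the quadratic. -/
theorem quadratic_nonpos {a b c L : ℝ} (ha : 0 ≤ a) (hb : 0 ≤ b) (hc : 0 ≤ c)
    (h2 : 2 * √(b * c) < 1 - a)
    (hL : 2 * c / (1 - a + √((1 - a) ^ 2 - 4 * b * c)) ≤ L)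
    (hL' : 2 * b * L < 1 - a + √((1 - a) ^ 2 - 4 * b * c)) :
    0 ≤ L ∧ b * L < 1 ∧ L * a + c ≤ L * (1 - b * L) := by
  have hsq := Real.sq_sqrt (mul_nonneg hb hc)
  have hsn := Real.sqrt_nonneg (b * c)
  have hΔ : 0 ≤ (1 - a) ^ 2 - 4 * b * c := by nlinarith
  have ht := Real.sq_sqrt hΔ
  have htn := Real.sqrt_nonneg ((1 - a) ^ 2 - 4 * b * c)
  set t := √((1 - a) ^ 2 - 4 * b * c)
  have hta : t ≤ 1 - a := by
    refine abs_le_of_sq_le_sq' ?_ (by linarith) |>.2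
    rw [ht]
    nlinarith
  have hs : 0 < 1 - a + t := by linarith
  rw [div_le_iff₀ hs] at hL
  have hL0 : 0 ≤ L := by
    by_contra hn
    nlinarith [mul_neg_of_neg_of_pos (not_le.1 hn) hs]
  refine ⟨hL0, by linarith, ?_⟩
  have hprod : 0 ≤ (L * (1 - a + t) - 2 * c) * (1 - a + t - 2 * b * L) :=
    mul_nonneg (by linarith) (by linarith)
  have hid : (L * (1 - a + t) - 2 * c) * (1 - a + t - 2 * b * L) =
      2 * (1 - a + t) * (L * (1 - b * L) - (L * a + c)) := by
    linear_combination (L) * ht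
  rw [hid] at hprod
  have := nonneg_of_mul_nonneg_right hprod (by linarith)
  linarith

end Transform

end LorenzFoliation

open LorenzFoliation in
theorem proposition3p3 {E : Type*} [NormedAddCommGroup E] [NormedSpace ℝ E] [FiniteDimensional ℝ E]
    (k : ℕ) (hk : 1 ≤ k) (T : E × ℝ → E × ℝ) (hT : LorenzFoliation.IsLorenzTypeMap k T)
    (L : ℝ) (hL : LorenzFoliation.smallRoot T ≤ L)
    (hL' : 2 * LorenzFoliation.supNorm (LorenzFoliation.colB T) * L <
      1 - LorenzFoliation.supNorm (LorenzFoliation.matA T) + √(LorenzFoliation.discr T))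
    (μ : E × ℝ → (E →L[ℝ] ℝ)) (hμ : μ ∈ LorenzFoliation.spaceA E L)
    (hμk : ContDiffOn ℝ (k : WithTop ℕ∞) μ (LorenzFoliation.dom E)) :
    (∀ i : ℕ, 1 ≤ i → i ≤ k → ∀ p ∈ LorenzFoliation.domZero E,
      Tendsto
        (iteratedFDerivWithin ℝ i (LorenzFoliation.graphTransform T μ) (LorenzFoliation.dom E))
        (𝓝[LorenzFoliation.dom E] p) (𝓝 0)) ∧
    LorenzFoliation.graphTransform T μ ∈ LorenzFoliation.spaceA E L ∧
    ContDiffOn ℝ (k : WithTop ℕ∞) (LorenzFoliation.graphTransform T μ) (LorenzFoliation.dom E) ∧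
    (∀ i : ℕ, 1 ≤ i → i ≤ k → ∀ p ∈ LorenzFoliation.domZero E,
      iteratedFDerivWithin ℝ i (LorenzFoliation.graphTransform T μ) (LorenzFoliation.dom E) p = 0) := by
  obtain ⟨r, hr, hw⟩ := hT.l1.exists_hasWeight hk
  have hr0 : 0 ≤ r := (Nat.cast_nonneg k).trans hr.le
  obtain ⟨hA, hB, hC⟩ := hT.contDiffOn_matA_colB_rowC
  have hbA := bddAbove_norm_image_domStar hA.continuousOn fun σ hσ => by
    obtain ⟨δ, hδ, -, h, -, -⟩ := hw σ hσ
    exact ⟨δ, hδ, (h.mono (isOneSided_strip hσ hδ) hr0).exists_norm_le⟩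
  have hbB := bddAbove_norm_image_domStar hB.continuousOn fun σ hσ => by
    obtain ⟨δ, hδ, -, -, h, -⟩ := hw σ hσ
    exact ⟨δ, hδ, h.exists_norm_le⟩
  have hbC := bddAbove_norm_image_domStar hC.continuousOn fun σ hσ => by
    obtain ⟨δ, hδ, -, -, -, h⟩ := hw σ hσ
    exact ⟨δ, hδ, (h.mono (isOneSided_strip hσ hδ) hr0).exists_norm_le⟩
  obtain ⟨hL0, hbL, hquad⟩ := quadratic_nonpos (supNorm_nonneg (matA T)) (supNorm_nonneg (colB T))
    (supNorm_nonneg (rowC T)) hT.l2 hL hL'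
  have hge : ∀ p ∈ domStar E, 1 - supNorm (colB T) * L ≤ 1 - μ (T p) (colB T p) := fun p hp => by
    have h1 : ‖colB T p‖ ≤ supNorm (colB T) := le_csSup hbB ⟨p, hp, rfl⟩
    have h2 := (μ (T p)).le_of_opNorm_le_of_le (hμ.2.1 _ (hT.mapsTo hp)) h1
    have h3 := (le_abs_self _).trans h2
    linarith
  have hpos : 0 < 1 - supNorm (colB T) * L := by linarith
  have hcd := contDiffOn_graphTransform hT hμk fun p hp => (hpos.trans_le (hge p hp)).ne'
  have hzero : ∀ p : E × ℝ, p.2 = 0 → graphTransform T μ p = 0 := fun p hp => by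
    simp [graphTransform, hp]
  obtain ⟨hcdD, hflat⟩ := contDiffOn_dom_of_hasWeight hcd (fun p hp => hzero p hp.2) hr
    fun σ hσ => by
      obtain ⟨δ, hδ, h1, h2, h3, h4⟩ := hw σ hσ
      exact ⟨δ, hδ, hasWeight_graphTransform hσ hδ hT.mapsTo hμk hpos
        (fun p hp => (hge p hp).trans (le_abs_self _)) h1 h2 h3 h4⟩
  refine ⟨fun i _ hi p hp => ?_, ⟨hcdD.continuousOn, fun p hp => ?_, fun x _ => hzero _ rfl⟩, hcdD,
    fun i _ hi p hp => hflat i hi p hp⟩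
  · have := hcdD.continuousOn_iteratedFDerivWithin (m := i) (by exact_mod_cast hi)
      uniqueDiffOn_dom p hp.1
    rwa [ContinuousWithinAt, hflat i hi p hp] at this
  · by_cases h : p.2 = 0
    · rw [hzero p h, norm_zero]
      exact hL0
    have hps : p ∈ domStar E := by
      rw [domStar_eq]
      exact ⟨hp, h⟩
    have hq := hpos.trans_le (hge p hps)
    have h1 : ‖matA T p‖ ≤ supNorm (matA T) := le_csSup hbA ⟨p, hps, rfl⟩
    have h2 : ‖rowC T p‖ ≤ supNorm (rowC T) := le_csSup hbC ⟨p, hps, rfl⟩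
    rw [graphTransform_of_ne h, norm_smul, norm_inv, Real.norm_eq_abs, abs_of_pos hq,
      inv_mul_le_iff₀ hq]
    calc ‖(μ (T p)).comp (matA T p) - rowC T p‖
        ≤ ‖μ (T p)‖ * ‖matA T p‖ + ‖rowC T p‖ :=
          (norm_sub_le _ _).trans (by gcongr; exact ContinuousLinearMap.opNorm_comp_le _ _)
      _ ≤ L * supNorm (matA T) + supNorm (rowC T) := by
          gcongr
          exact hμ.2.1 _ (hT.mapsTo hps)
      _ ≤ L * (1 - supNorm (colB T) * L) := hquad
      _ ≤ L * (1 - μ (T p) (colB T p)) := mul_le_mul_of_nonneg_left (hge p hps) hL0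
      _ = (1 - μ (T p) (colB T p)) * L := mul_comm _ _
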